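/- For an integer $n\ge 0$, let $AD(n)$, the Aztec diamond of order $n$, be the union of all unit squares of the square lattice $\mathbb{Z}^2$ that lie inside the contour $|x|+|y|=n+1$. A domino is the union of two unit squares of the lattice that share an edge, and a domino tiling of $AD(n)$ is a set of dominoes contained in $AD(n)$ such that each unit square of $AD(n)$ belongs to exactly one of them. The planar dual graph of $AD(n)$ has the unit squares of $AD(n)$ as vertices, two of them being joined by an edge when they share an edge; let $M(AD(n))$ be the number of its perfect matchings. Theorem (Aztec Diamond Theorem). For every $n\ge 0$, the number of domino tilings of $AD(n)$ is $2^{n(n+1)/2}$, and likewise $M(AD(n))=2^{n(n+1)/2}$. In particular, $M(AD(n))=2^{n}\,M(AD(n-1))$ for every $n\ge 1$. -/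

import Mathlib

/-- The closed unit square of the plane whose lower left corner is the lattice point `c`.
The lattice point `c` is used as the name of this square. -/
def unitSquare (c : ℤ × ℤ) : Set (ℝ × ℝ) :=
  Set.Icc (c.1 : ℝ) (c.1 + 1) ×ˢ Set.Icc (c.2 : ℝ) (c.2 + 1)

/-- The Aztec diamond of order `n`, given by its unit squares: all unit squares with corners in
the lattice that lie inside the contour `|x| + |y| = n + 1`. -/
def aztecDiamond (n : ℕ) : Set (ℤ × ℤ) :=
  {c | unitSquare c ⊆ {z : ℝ × ℝ | |z.1| + |z.2| ≤ (n : ℝ) + 1}}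

/-- The adjacency graph of the unit squares of the plane: two of them are adjacent when they
share an edge, that is, when one is the translate of the other by one unit horizontally or
vertically. -/
def squareGrid : SimpleGraph (ℤ × ℤ) where
  Adj c d := (c.2 = d.2 ∧ |c.1 - d.1| = 1) ∨ (c.1 = d.1 ∧ |c.2 - d.2| = 1)
  symm := ⟨fun c d h => by
    rcases h with ⟨h, h'⟩ | ⟨h, h'⟩
    · exact Or.inl ⟨h.symm, by rwa [abs_sub_comm]⟩
    · exact Or.inr ⟨h.symm, by rwa [abs_sub_comm]⟩⟩
  loopless := ⟨fun c h => by simp at h⟩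

/-- A domino consists of two unit squares that share an edge. -/
def IsDomino (s : Finset (ℤ × ℤ)) : Prop :=
  ∃ c d : ℤ × ℤ, squareGrid.Adj c d ∧ s = {c, d}

/-- `T` is a domino tiling of the region made of the unit squares in `R`: its members are dominoes
that lie in the region, and each unit square of the region is covered by exactly one of them. -/
def IsDominoTiling (R : Set (ℤ × ℤ)) (T : Set (Finset (ℤ × ℤ))) : Prop :=
  (∀ s ∈ T, IsDomino s ∧ ∀ c ∈ s, c ∈ R) ∧ ∀ c ∈ R, ∃! s, s ∈ T ∧ c ∈ s

/-- The number of domino tilings of a region made of unit squares. -/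
noncomputable def numDominoTilings (R : Set (ℤ × ℤ)) : ℕ :=
  {T : Set (Finset (ℤ × ℤ)) | IsDominoTiling R T}.ncard

/-- The planar dual graph of a region made of unit squares: its vertices are the unit squares of
the region, joined when they share an edge. -/
def dualGraph (R : Set (ℤ × ℤ)) : SimpleGraph R :=
  squareGrid.induce R

/-- The number of perfect matchings of a graph. -/
noncomputable def numPerfectMatchings {V : Type*} (G : SimpleGraph V) : ℕ :=
  {M : G.Subgraph | M.IsPerfectMatching}.ncard

/-! ### Perfect matchings of the dual graph are domino tilings -/

/-! This is a complementation argument. The dual graph of order `n + 1` has its edges partitioned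
into `(n + 1) ^ 2` four-cycles (cells); squares of order `n` lie in two cells, the remaining ones in
exactly one. For a tiling, record in each cell `p` the set `K p` of vertices matched inside that
cell. The tilings with given `K` number `∏ p, cycleWeight (K p)`, and `K` comes into play exactly
when it covers every square once. Replacing each `K p` by its complement turns the families for
order `n + 1` into those for order `n`, since cover counts two and one drop to one and zero. By
`two_mul_cycleWeight` each cell contributes a factor `√2 ^ |K p| / 2`, and the `|K p|` add up to the
number of squares, so the total factor is independent of `K`. Hence `two_pow_mul_numDominoTilings`,
and counting cells and squares gives the factor `2 ^ (n + 1)`. -/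

theorem IsDomino.adj {c d : ℤ × ℤ} (h : IsDomino {c, d}) : squareGrid.Adj c d := by
  obtain ⟨a, b, hab, h⟩ := h
  have hc : c ∈ ({a, b} : Finset (ℤ × ℤ)) := h ▸ by simp
  have hd : d ∈ ({a, b} : Finset (ℤ × ℤ)) := h ▸ by simp
  have ha : a ∈ ({c, d} : Finset (ℤ × ℤ)) := h ▸ by simp
  have hb : b ∈ ({c, d} : Finset (ℤ × ℤ)) := h ▸ by simp
  have hne := hab.ne
  simp only [Finset.mem_insert, Finset.mem_singleton] at hc hd ha hb
  rcases hc with rfl | rfl <;> rcases hd with rfl | rfl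
  · simp_all
  · exact hab
  · exact hab.symm
  · simp_all

/-- The dominoes given by the edges of a subgraph of the dual graph of a region. -/
def dominoesOfSubgraph {R : Set (ℤ × ℤ)} (M : (dualGraph R).Subgraph) :
    Set (Finset (ℤ × ℤ)) :=
  {s | ∃ c d : R, M.Adj c d ∧ s = {c.1, d.1}}

theorem pair_mem_dominoesOfSubgraph {R : Set (ℤ × ℤ)} (M : (dualGraph R).Subgraph) (c d : R) :
    {c.1, d.1} ∈ dominoesOfSubgraph M ↔ M.Adj c d := by
  refine ⟨?_, fun h => ⟨c, d, h, rfl⟩⟩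
  rintro ⟨a, b, hab, h⟩
  have hc : c.1 ∈ ({a.1, b.1} : Finset (ℤ × ℤ)) := h ▸ by simp
  have hd : d.1 ∈ ({a.1, b.1} : Finset (ℤ × ℤ)) := h ▸ by simp
  have ha : a.1 ∈ ({c.1, d.1} : Finset (ℤ × ℤ)) := h ▸ by simp
  have hb : b.1 ∈ ({c.1, d.1} : Finset (ℤ × ℤ)) := h ▸ by simp
  have hne := hab.ne
  simp only [Finset.mem_insert, Finset.mem_singleton, Subtype.coe_inj] at hc hd ha hb
  rcases hc with rfl | rfl <;> rcases hd with rfl | rfl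
  · simp_all
  · exact hab
  · exact hab.symm
  · simp_all

/-- The edges of the dual graph of a region given by a domino tiling of the region. -/
def subgraphOfTiling {R : Set (ℤ × ℤ)} {T : Set (Finset (ℤ × ℤ))} (hT : IsDominoTiling R T) :
    (dualGraph R).Subgraph where
  verts := Set.univ
  Adj c d := {c.1, d.1} ∈ T
  adj_sub h := (hT.1 _ h).1.adj
  edge_vert _ := Set.mem_univ _
  symm := ⟨fun c d h => by rwa [Finset.pair_comm] at h⟩

theorem numPerfectMatchings_dualGraph (R : Set (ℤ × ℤ)) :
    numPerfectMatchings (dualGraph R) = numDominoTilings R := by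
  refine Set.ncard_congr (fun M _ => dominoesOfSubgraph M) ?_ ?_ ?_
  · rintro M ⟨hM, hs⟩
    refine ⟨?_, fun c hc => ?_⟩
    · rintro s ⟨c, d, h, rfl⟩
      refine ⟨⟨c, d, M.adj_sub h, rfl⟩, ?_⟩
      simp
    · obtain ⟨d, hd, hu⟩ := hM (hs ⟨c, hc⟩)
      refine ⟨{c, d.1}, ⟨⟨⟨c, hc⟩, d, hd, rfl⟩, by simp⟩, ?_⟩
      rintro s ⟨⟨a, b, hab, rfl⟩, hcs⟩
      simp only [Finset.mem_insert, Finset.mem_singleton] at hcs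
      rcases hcs with rfl | rfl
      · rw [hu b hab]
      · rw [hu a hab.symm, Finset.pair_comm]
  · rintro M N ⟨_, hM⟩ ⟨_, hN⟩ h
    refine SimpleGraph.Subgraph.ext ?_ ?_
    · rw [SimpleGraph.Subgraph.isSpanning_iff.1 hM, SimpleGraph.Subgraph.isSpanning_iff.1 hN]
    · ext c d
      rw [← pair_mem_dominoesOfSubgraph, ← pair_mem_dominoesOfSubgraph, h]
  · intro T hT
    refine ⟨subgraphOfTiling hT, ⟨?_, fun v => Set.mem_univ v⟩, ?_⟩
    · intro c _
      obtain ⟨s, ⟨hs, hcs⟩, hu⟩ := hT.2 c c.2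
      obtain ⟨⟨a, b, hab, rfl⟩, hR⟩ := hT.1 s hs
      have key : ∀ d : ℤ × ℤ, ({a, b} : Finset (ℤ × ℤ)) = {c.1, d} →
          ∃! w : R, (subgraphOfTiling hT).Adj c w := by
        intro d hd
        have hdR : d ∈ R := hR d (by rw [hd]; simp)
        refine ⟨⟨d, hdR⟩, show {c.1, d} ∈ T from hd ▸ hs, ?_⟩
        intro w hw
        have hw' : {c.1, w.1} ∈ T := hw
        have h1 : ({c.1, w.1} : Finset (ℤ × ℤ)) = {c.1, d} :=
          (hu _ ⟨hw', by simp⟩).trans hd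
        have h2 := (hT.1 _ hw').1.adj.ne
        have h3 : w.1 ∈ ({c.1, d} : Finset (ℤ × ℤ)) := h1 ▸ by simp
        simp only [Finset.mem_insert, Finset.mem_singleton] at h3
        exact Subtype.ext (h3.resolve_left h2.symm)
      simp only [Finset.mem_insert, Finset.mem_singleton] at hcs
      rcases hcs with h | h
      · exact key b (by rw [h])
      · exact key a (by rw [h, Finset.pair_comm])
    · ext s
      constructor
      · rintro ⟨c, d, h, rfl⟩
        exact h
      · intro hs
        obtain ⟨⟨a, b, hab, rfl⟩, hR⟩ := hT.1 s hs
        exact ⟨⟨a, hR a (by simp)⟩, ⟨b, hR b (by simp)⟩, hs, rfl⟩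

/-! ### Matchings of a four-cycle -/

/-- The edge set `e` of the four-cycle, in which the edge `i` joins `i` and `i + 1`, is a matching
that covers exactly the vertices in `k`. -/
def CoversExactly (e k : Finset (Fin 4)) : Prop :=
  ∀ i, ((if i ∈ e then 1 else 0) + (if i - 1 ∈ e then 1 else 0) : ℕ) = if i ∈ k then 1 else 0

instance (e k : Finset (Fin 4)) : Decidable (CoversExactly e k) :=
  inferInstanceAs (Decidable (∀ _, _))

/-- The number of matchings of the four-cycle that cover exactly the vertices in `k`. -/
def cycleWeight (k : Finset (Fin 4)) : ℕ :=
  (Finset.univ.filter fun e => CoversExactly e k).card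

/-- The weight is 1 for the empty set, 2 for the whole cycle, 1 for two neighbours, and 0 for
opposite pairs and odd sets. -/
theorem cycleWeight_cases (k : Finset (Fin 4)) :
    (k.card = 0 ∧ 2 * cycleWeight k = cycleWeight kᶜ) ∨
    (k.card = 2 ∧ cycleWeight k = cycleWeight kᶜ) ∨
    (k.card = 4 ∧ cycleWeight k = 2 * cycleWeight kᶜ) ∨
    (cycleWeight k = 0 ∧ cycleWeight kᶜ = 0) := by
  revert k
  decide +kernel

/-- Writing the ratios 1/2, 1, 2 as `√2 ^ k.card / 2` makes their product over the cells depend only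
on the total number of covered vertices. -/
theorem two_mul_cycleWeight (k : Finset (Fin 4)) :
    (2 * cycleWeight k : ℝ) = √2 ^ k.card * cycleWeight kᶜ := by
  have h2 : √2 ^ 2 = 2 := Real.sq_sqrt (by norm_num)
  have h4 : √2 ^ 4 = 4 := by rw [show 4 = 2 * 2 from rfl, pow_mul, h2]; norm_num
  rcases cycleWeight_cases k with ⟨h, h'⟩ | ⟨h, h'⟩ | ⟨h, h'⟩ | ⟨h, h'⟩
  · rw [h, ← h']; push_cast; ring
  · rw [h, h', h2]
  · rw [h, h', h4]; push_cast; ring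
  · rw [h, h']; simp

/-! ### Regions whose edges are partitioned into four-cycles -/

section Cells

variable {ι : Type*} [Fintype ι]

/-- The number of pairs of a cell `p` and a vertex `i` of it in `K p` that give the square `v`. -/
def coverCount (σ : ι → Fin 4 → ℤ × ℤ) (K : ι → Finset (Fin 4)) (v : ℤ × ℤ) : ℕ :=
  ∑ p, ∑ i, if i ∈ K p ∧ σ p i = v then 1 else 0

/-- Each square of `R`, and no other square, is covered by `K` exactly once. -/
def CoversOnce (σ : ι → Fin 4 → ℤ × ℤ) (R : Set (ℤ × ℤ)) (K : ι → Finset (Fin 4)) : Prop :=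
  ∀ v, coverCount σ K v = R.indicator 1 v

/-- The domino given by the edge `x.2` of the cell `x.1`. -/
def cellDomino (σ : ι → Fin 4 → ℤ × ℤ) (x : ι × Fin 4) : Finset (ℤ × ℤ) :=
  {σ x.1 x.2, σ x.1 (x.2 + 1)}

/-- The edges in `E` give dominoes that cover each square of `R`, and no other square, exactly
once. -/
def EdgesCoverOnce (σ : ι → Fin 4 → ℤ × ℤ) (R : Set (ℤ × ℤ)) (E : ι → Finset (Fin 4)) : Prop :=
  ∀ v, (∑ p, ∑ i, if i ∈ E p ∧ v ∈ cellDomino σ (p, i) then 1 else 0 : ℕ) = R.indicator 1 v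

open Classical in
theorem sum_edges_eq_coverCount {σ : ι → Fin 4 → ℤ × ℤ} (hσ : ∀ p i, σ p i ≠ σ p (i + 1))
    {E K : ι → Finset (Fin 4)} (h : ∀ p, CoversExactly (E p) (K p)) (v : ℤ × ℤ) :
    (∑ p, ∑ i, if i ∈ E p ∧ v ∈ cellDomino σ (p, i) then 1 else 0) = coverCount σ K v := by
  refine Finset.sum_congr rfl fun p _ => ?_
  have h1 : ∀ i, (if i ∈ E p ∧ v ∈ cellDomino σ (p, i) then 1 else 0 : ℕ) =
      (if i ∈ E p ∧ σ p i = v then 1 else 0) + if i ∈ E p ∧ σ p (i + 1) = v then 1 else 0 := by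
    intro i
    have := hσ p i
    simp only [cellDomino, Finset.mem_insert, Finset.mem_singleton, eq_comm (a := v)]
    by_cases h1 : σ p i = v <;> by_cases h2 : σ p (i + 1) = v <;> by_cases h3 : i ∈ E p <;>
      simp_all
  -- Reindex by the far endpoint: vertex `i` is the end of edges `i` and `i - 1`.
  have h2 : (∑ i, if i ∈ E p ∧ σ p (i + 1) = v then 1 else 0 : ℕ) =
      ∑ i, if i - 1 ∈ E p ∧ σ p i = v then 1 else 0 :=
    Fintype.sum_equiv (Equiv.addRight 1) _ _ fun i => by simp
  rw [Finset.sum_congr rfl fun i _ => h1 i, Finset.sum_add_distrib, h2, ← Finset.sum_add_distrib]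
  refine Finset.sum_congr rfl fun i _ => ?_
  have := h p i
  by_cases h3 : σ p i = v <;> simp_all

/-- Two chosen edges of one cell that met at a vertex would cover its square twice. -/
theorem exists_coversExactly_of_edgesCoverOnce {σ : ι → Fin 4 → ℤ × ℤ} {R : Set (ℤ × ℤ)}
    {E : ι → Finset (Fin 4)} (h : EdgesCoverOnce σ R E) (p : ι) :
    ∃ k, CoversExactly (E p) k := by
  classical
  refine ⟨Finset.univ.filter fun i => i ∈ E p ∨ i - 1 ∈ E p, fun i => ?_⟩
  have hne : i - 1 ≠ i := by revert i; decide
  have : ¬ (i ∈ E p ∧ i - 1 ∈ E p) := by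
    rintro ⟨h1, h2⟩
    have hle : (2 : ℕ) ≤ R.indicator 1 (σ p i) := by
      rw [← h (σ p i)]
      refine le_trans ?_ (Finset.single_le_sum (f := fun p => ∑ j, if j ∈ E p ∧
        σ _ i ∈ cellDomino σ (p, j) then 1 else 0) (fun _ _ => Nat.zero_le _) (Finset.mem_univ p))
      rw [← Finset.card_filter, ← Finset.card_pair hne]
      refine Finset.card_le_card fun j hj => ?_
      simp only [Finset.mem_insert, Finset.mem_singleton] at hj
      rcases hj with rfl | rfl <;> simp [cellDomino, h1, h2]
    have := Set.indicator_le_self' (s := R) (f := (1 : ℤ × ℤ → ℕ)) (by simp) (σ p i)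
    simp only [Pi.one_apply] at this
    omega
  by_cases h1 : i ∈ E p <;> by_cases h2 : i - 1 ∈ E p <;> simp_all

theorem CoversExactly.unique {e k k' : Finset (Fin 4)} (h : CoversExactly e k)
    (h' : CoversExactly e k') : k = k' := by
  ext i
  have := (h i).symm.trans (h' i)
  by_cases h1 : i ∈ k <;> by_cases h2 : i ∈ k' <;> simp_all

-- An edge choice determines its `K`, so the choices form a disjoint union over `K` of products over
-- the cells.
open Classical in
theorem card_edgesCoverOnce {σ : ι → Fin 4 → ℤ × ℤ} (hσ : ∀ p i, σ p i ≠ σ p (i + 1))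
    (R : Set (ℤ × ℤ)) :
    (Finset.univ.filter fun E : ι → Finset (Fin 4) => EdgesCoverOnce σ R E).card =
      ∑ K : ι → Finset (Fin 4) with CoversOnce σ R K, ∏ p, cycleWeight (K p) := by
  have h : (Finset.univ.filter fun E : ι → Finset (Fin 4) => EdgesCoverOnce σ R E) =
      (Finset.univ.filter fun K : ι → Finset (Fin 4) => CoversOnce σ R K).biUnion fun K =>
        Fintype.piFinset fun p => Finset.univ.filter fun e => CoversExactly e (K p) := by
    ext E
    simp only [Finset.mem_filter, Finset.mem_univ, true_and, Finset.mem_biUnion,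
      Fintype.mem_piFinset]
    constructor
    · intro hE
      choose K hK using exists_coversExactly_of_edgesCoverOnce hE
      exact ⟨K, fun v => (sum_edges_eq_coverCount hσ hK v).symm.trans (hE v), hK⟩
    · rintro ⟨K, hK, hEK⟩ v
      exact (sum_edges_eq_coverCount hσ hEK v).trans (hK v)
  rw [h, Finset.card_biUnion]
  · exact Finset.sum_congr rfl fun K _ => Fintype.card_piFinset _
  · intro K _ K' _ hne
    refine Finset.disjoint_left.2 fun E hE hE' => hne ?_
    simp only [Finset.mem_filter, Finset.mem_univ, true_and, Fintype.mem_piFinset] at hE hE'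
    exact funext fun p => (hE p).unique (hE' p)

theorem edgesCoverOnce_iff {σ : ι → Fin 4 → ℤ × ℤ} {R : Set (ℤ × ℤ)} {E : ι → Finset (Fin 4)} :
    EdgesCoverOnce σ R E ↔ (∀ x : ι × Fin 4, x.2 ∈ E x.1 → ∀ c ∈ cellDomino σ x, c ∈ R) ∧
      ∀ c ∈ R, ∃! x : ι × Fin 4, x.2 ∈ E x.1 ∧ c ∈ cellDomino σ x := by
  classical
  have key : ∀ v, (∑ p, ∑ i, if i ∈ E p ∧ v ∈ cellDomino σ (p, i) then 1 else 0 : ℕ) =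
      (Finset.univ.filter fun x : ι × Fin 4 => x.2 ∈ E x.1 ∧ v ∈ cellDomino σ x).card := by
    intro v
    rw [Finset.card_filter, Fintype.sum_prod_type]
  simp only [EdgesCoverOnce, key]
  constructor
  · intro h
    refine ⟨fun x hx c hc => ?_, fun c hc => ?_⟩
    · by_contra hR
      have := h c
      rw [Set.indicator_of_notMem hR, Finset.card_eq_zero] at this
      have hx' : x ∈ (∅ : Finset (ι × Fin 4)) := by rw [← this]; simp [hx, hc]
      simp at hx'
    · have := h c
      rw [Set.indicator_of_mem hc, Pi.one_apply, Finset.card_eq_one] at this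
      obtain ⟨x, hx⟩ := this
      simp only [Finset.ext_iff, Finset.mem_filter, Finset.mem_univ, true_and,
        Finset.mem_singleton] at hx
      exact ⟨x, (hx x).2 rfl, fun y hy => (hx y).1 hy⟩
  · rintro ⟨h1, h2⟩ v
    by_cases hv : v ∈ R
    · obtain ⟨x, hx, hu⟩ := h2 v hv
      rw [Set.indicator_of_mem hv, Pi.one_apply, Finset.card_eq_one]
      refine ⟨x, ?_⟩
      ext y
      simp only [Finset.mem_filter, Finset.mem_univ, true_and, Finset.mem_singleton]
      exact ⟨hu y, fun h => h ▸ hx⟩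
    · rw [Set.indicator_of_notMem hv, Finset.card_eq_zero, Finset.filter_eq_empty_iff]
      exact fun x _ hx => hv (h1 x hx.1 v hx.2)

-- Cell edges name dominoes without repetition, so a tiling is a choice of cell edges. Only dominoes
-- inside `R` need a name, and cells may stick out of `R`; thus the same cells serve the larger and
-- the smaller region.
open Classical in
theorem numDominoTilings_eq_sum {σ : ι → Fin 4 → ℤ × ℤ} {R : Set (ℤ × ℤ)}
    (hadj : ∀ p i, squareGrid.Adj (σ p i) (σ p (i + 1)))
    (hinj : Function.Injective (cellDomino σ))
    (hsurj : ∀ c ∈ R, ∀ d ∈ R, squareGrid.Adj c d → ∃ x, cellDomino σ x = {c, d}) :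
    numDominoTilings R =
      ∑ K : ι → Finset (Fin 4) with CoversOnce σ R K, ∏ p, cycleWeight (K p) := by
  rw [← card_edgesCoverOnce fun p i => (hadj p i).ne, ← Set.ncard_coe_finset]
  symm
  refine Set.ncard_congr (fun E _ => cellDomino σ '' {x | x.2 ∈ E x.1}) ?_ ?_ ?_
  · intro E hE
    simp only [Finset.coe_filter, Finset.mem_univ, true_and, Set.mem_ofPred_eq,
      edgesCoverOnce_iff] at hE
    obtain ⟨h1, h2⟩ := hE
    refine ⟨?_, fun c hc => ?_⟩
    · rintro _ ⟨x, hx, rfl⟩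
      exact ⟨⟨_, _, hadj x.1 x.2, rfl⟩, h1 x hx⟩
    · obtain ⟨x, ⟨hx, hcx⟩, hu⟩ := h2 c hc
      refine ⟨cellDomino σ x, ⟨⟨x, hx, rfl⟩, hcx⟩, ?_⟩
      rintro _ ⟨⟨y, hy, rfl⟩, hcy⟩
      rw [hu y ⟨hy, hcy⟩]
  · intro E E' _ _ h
    have h := hinj.image_injective h
    ext p i
    exact Set.ext_iff.1 h (p, i)
  · intro T hT
    have hpre : ∀ s ∈ T, ∃ x, cellDomino σ x = s := by
      intro s hs
      obtain ⟨⟨c, d, hcd, rfl⟩, hR⟩ := hT.1 s hs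
      exact hsurj c (hR c (by simp)) d (hR d (by simp)) hcd
    refine ⟨fun p => Finset.univ.filter fun i => cellDomino σ (p, i) ∈ T, ?_, ?_⟩
    · simp only [Finset.coe_filter, Finset.mem_univ, true_and, Set.mem_ofPred_eq,
        edgesCoverOnce_iff, Finset.mem_filter]
      refine ⟨fun x hx => (hT.1 _ hx).2, fun c hc => ?_⟩
      obtain ⟨s, ⟨hs, hcs⟩, hu⟩ := hT.2 c hc
      obtain ⟨x, rfl⟩ := hpre s hs
      exact ⟨x, ⟨hs, hcs⟩, fun y hy => hinj (hu _ hy)⟩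
    · ext s
      simp only [Finset.mem_filter, Finset.mem_univ, true_and, Set.mem_image, Set.mem_ofPred_eq]
      constructor
      · rintro ⟨x, hx, rfl⟩
        exact hx
      · intro hs
        obtain ⟨x, rfl⟩ := hpre s hs
        exact ⟨x, hs, rfl⟩

theorem coverCount_add_compl (σ : ι → Fin 4 → ℤ × ℤ) (K : ι → Finset (Fin 4)) (v : ℤ × ℤ) :
    coverCount σ K v + coverCount σ Kᶜ v = coverCount σ (fun _ => Finset.univ) v := by
  simp only [coverCount, ← Finset.sum_add_distrib]
  refine Finset.sum_congr rfl fun p _ => Finset.sum_congr rfl fun i _ => ?_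
  by_cases h1 : i ∈ K p <;> by_cases h2 : σ p i = v <;> simp [h1, h2]

theorem sum_coverCount {σ : ι → Fin 4 → ℤ × ℤ} {S : Finset (ℤ × ℤ)} (hS : ∀ p i, σ p i ∈ S)
    (K : ι → Finset (Fin 4)) : ∑ v ∈ S, coverCount σ K v = ∑ p, (K p).card := by
  simp only [coverCount]
  rw [Finset.sum_comm]
  refine Finset.sum_congr rfl fun p _ => ?_
  rw [Finset.sum_comm]
  have : ∀ i, (∑ v ∈ S, if i ∈ K p ∧ σ p i = v then 1 else 0 : ℕ) =
      if i ∈ K p then 1 else 0 := by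
    intro i
    by_cases h : i ∈ K p <;> simp [h, hS p i]
  simp [this]

open Classical in
/-- The complementation theorem for regions with a common partition into four-cycles. -/
theorem two_pow_mul_numDominoTilings {σ : ι → Fin 4 → ℤ × ℤ} {S S' : Finset (ℤ × ℤ)}
    (hadj : ∀ p i, squareGrid.Adj (σ p i) (σ p (i + 1)))
    (hinj : Function.Injective (cellDomino σ))
    (hsurj : ∀ c ∈ S, ∀ d ∈ S, squareGrid.Adj c d → ∃ x, cellDomino σ x = {c, d})
    (hsub : S' ⊆ S) (hmem : ∀ p i, σ p i ∈ S)
    (hcount : ∀ v, coverCount σ (fun _ => Finset.univ) v =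
      Set.indicator (S : Set (ℤ × ℤ)) 1 v + Set.indicator (S' : Set (ℤ × ℤ)) 1 v) :
    (2 ^ Fintype.card ι * numDominoTilings (S : Set (ℤ × ℤ)) : ℝ) =
      √2 ^ S.card * numDominoTilings (S' : Set (ℤ × ℤ)) := by
  rw [numDominoTilings_eq_sum hadj hinj (R := (S : Set (ℤ × ℤ))) (by exact_mod_cast hsurj),
    numDominoTilings_eq_sum hadj hinj (R := (S' : Set (ℤ × ℤ)))
      fun c hc d hd => hsurj c (hsub hc) d (hsub hd)]
  push_cast
  rw [Finset.mul_sum, Finset.mul_sum]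
  -- Complementation matches the terms of the two sums.
  refine Finset.sum_nbij' (fun K => Kᶜ) (fun K => Kᶜ) ?_ ?_ (by simp) (by simp) ?_
  · intro K hK
    simp only [Finset.mem_filter, Finset.mem_univ, true_and] at hK ⊢
    intro v
    have h1 := hK v
    have h2 := coverCount_add_compl σ K v
    have h3 := hcount v
    omega
  · intro K hK
    simp only [Finset.mem_filter, Finset.mem_univ, true_and] at hK ⊢
    intro v
    have h1 := hK v
    have h2 := coverCount_add_compl σ K v
    have h3 := hcount v
    omega
  · intro K hK
    simp only [Finset.mem_filter, Finset.mem_univ, true_and] at hK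
    have hcard : S.card = ∑ p, (K p).card := by
      rw [← sum_coverCount hmem K, Finset.card_eq_sum_ones]
      refine Finset.sum_congr rfl fun v hv => ?_
      rw [hK v, Set.indicator_of_mem (Finset.mem_coe.2 hv), Pi.one_apply]
    rw [hcard, ← Finset.prod_pow_eq_pow_sum, ← Finset.prod_mul_distrib, ← Finset.card_univ,
      ← Finset.prod_const, ← Finset.prod_mul_distrib]
    exact Finset.prod_congr rfl fun p _ => two_mul_cycleWeight (K p)

end Cells

/-! ### The cells of the Aztec diamond -/

/-- Each of the linear forms `±x ± y` is largest over the square at a corner, so the corners decide;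
the `+ 1` appears because `c` is the lower left one. -/
theorem mem_aztecDiamond {n : ℕ} {c : ℤ × ℤ} : c ∈ aztecDiamond n ↔
    (-(n : ℤ) ≤ c.1 + c.2 + 1 ∧ c.1 + c.2 + 1 ≤ n) ∧ -(n : ℤ) ≤ c.1 - c.2 ∧ c.1 - c.2 ≤ n := by
  obtain ⟨x, y⟩ := c
  simp only [aztecDiamond, unitSquare, Set.mem_ofPred_eq]
  constructor
  · intro h
    have corner : ∀ a b : ℝ, (a = 0 ∨ a = 1) → (b = 0 ∨ b = 1) →
        |(x : ℝ) + a| + |(y : ℝ) + b| ≤ n + 1 := by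
      intro a b ha hb
      refine h (a := ((x : ℝ) + a, (y : ℝ) + b)) ⟨⟨?_, ?_⟩, ⟨?_, ?_⟩⟩ <;>
        rcases ha with rfl | rfl <;> rcases hb with rfl | rfl <;> simp
    have h00 := corner 0 0 (by simp) (by simp)
    have h01 := corner 0 1 (by simp) (by simp)
    have h10 := corner 1 0 (by simp) (by simp)
    have h11 := corner 1 1 (by simp) (by simp)
    refine ⟨⟨?_, ?_⟩, ?_, ?_⟩ <;> rify
    · linarith [neg_abs_le ((x : ℝ) + 0), neg_abs_le ((y : ℝ) + 0)]
    · linarith [le_abs_self ((x : ℝ) + 1), le_abs_self ((y : ℝ) + 1)]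
    · linarith [neg_abs_le ((x : ℝ) + 0), le_abs_self ((y : ℝ) + 1)]
    · linarith [le_abs_self ((x : ℝ) + 1), neg_abs_le ((y : ℝ) + 0)]
  · rintro ⟨⟨h1, h2⟩, h3, h4⟩ ⟨a, b⟩ ⟨⟨ha, ha'⟩, hb, hb'⟩
    rify at h1 h2 h3 h4
    simp only [Set.mem_ofPred_eq] at *
    rcases abs_cases a with ⟨h, _⟩ | ⟨h, _⟩ <;> rcases abs_cases b with ⟨h', _⟩ | ⟨h', _⟩ <;>
      rw [h, h'] <;> linarith

/-- The vertices of the cells of the Aztec diamond of order `n`, in cyclic order. The cells are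
the blocks of four squares around the lattice points `(a, b)` with `|a| + |b| < n` for which
`a + b + n` is odd. -/
def aztecCell (n : ℕ) (p : Fin n × Fin n) (i : Fin 4) : ℤ × ℤ :=
  ((p.1 : ℤ) + (p.2 : ℤ) - n + 1 + ![0, -1, -1, 0] i, (p.1 : ℤ) - (p.2 : ℤ) + ![0, 0, -1, -1] i)

theorem aztecCell_adj (n : ℕ) (p : Fin n × Fin n) (i : Fin 4) :
    squareGrid.Adj (aztecCell n p i) (aztecCell n p (i + 1)) := by
  fin_cases i <;> simp [aztecCell, squareGrid]

theorem aztecCell_mem (n : ℕ) (p : Fin n × Fin n) (i : Fin 4) :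
    aztecCell n p i ∈ aztecDiamond n := by
  have h1 := p.1.2
  have h2 := p.2.2
  rw [mem_aztecDiamond]
  fin_cases i <;> simp [aztecCell] <;> omega

theorem cellDomino_aztecCell_injective (n : ℕ) :
    Function.Injective (cellDomino (aztecCell n)) := by
  rintro ⟨⟨a, b⟩, i⟩ ⟨⟨c, d⟩, j⟩ h
  have h1 : aztecCell n (a, b) i ∈ cellDomino (aztecCell n) ((c, d), j) := by
    rw [← h]; simp [cellDomino]
  have h2 : aztecCell n (a, b) (i + 1) ∈ cellDomino (aztecCell n) ((c, d), j) := by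
    rw [← h]; simp [cellDomino]
  clear h
  have : (a : ℕ) = c ∧ (b : ℕ) = d ∧ i = j := by
    fin_cases i <;> fin_cases j <;> simp [cellDomino, aztecCell] at h1 h2 ⊢ <;> omega
  obtain ⟨ha, hb, rfl⟩ := this
  rw [Fin.ext ha, Fin.ext hb]

/-- The indices are the centre's coordinates rotated by 45 degrees; by oddness the floored halves
are `(a ± b + n - 1) / 2`. -/
theorem exists_cell {n : ℕ} {a b : ℤ} (h1 : -(n : ℤ) < a + b) (h2 : a + b < n)
    (h3 : -(n : ℤ) < a - b) (h4 : a - b < n) (h5 : (a + b + n) % 2 = 1) :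
    ∃ p : Fin n × Fin n, (p.1 : ℤ) + (p.2 : ℤ) - n + 1 = a ∧ (p.1 : ℤ) - (p.2 : ℤ) = b :=
  ⟨(⟨((a + b + n) / 2).toNat, by omega⟩, ⟨((a - b + n) / 2).toNat, by omega⟩), by
    simp only; omega, by simp only; omega⟩

/-- The edge shared by two squares has endpoints of opposite parity, so exactly one of them has the
parity of a cell centre. -/
theorem exists_cellDomino_aztecCell {n : ℕ} {c d : ℤ × ℤ} (hc : c ∈ aztecDiamond n)
    (hd : d ∈ aztecDiamond n) (h : squareGrid.Adj c d) :
    ∃ x, cellDomino (aztecCell n) x = {c, d} := by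
  have key : ∀ c ∈ aztecDiamond n, ∀ d ∈ aztecDiamond n,
      (d = (c.1 + 1, c.2) ∨ d = (c.1, c.2 + 1)) → ∃ x, cellDomino (aztecCell n) x = {c, d} := by
    rintro ⟨x, y⟩ hc d hd h
    rcases h with rfl | rfl <;> simp only [mem_aztecDiamond] at hc hd <;>
      rcases Int.emod_two_eq_zero_or_one (x + y + n) with hp | hp
    · obtain ⟨p, h1, h2⟩ := exists_cell (n := n) (a := x + 1) (b := y) (by omega) (by omega)
        (by omega) (by omega) (by omega)
      refine ⟨(p, 0), ?_⟩
      simp [cellDomino, aztecCell, h1, h2, Finset.pair_comm]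
    · obtain ⟨p, h1, h2⟩ := exists_cell (n := n) (a := x + 1) (b := y + 1) (by omega) (by omega)
        (by omega) (by omega) (by omega)
      refine ⟨(p, 2), ?_⟩
      simp [cellDomino, aztecCell, h1, h2]
    · obtain ⟨p, h1, h2⟩ := exists_cell (n := n) (a := x) (b := y + 1) (by omega) (by omega)
        (by omega) (by omega) (by omega)
      refine ⟨(p, 3), ?_⟩
      simp [cellDomino, aztecCell, h1, h2]
    · obtain ⟨p, h1, h2⟩ := exists_cell (n := n) (a := x + 1) (b := y + 1) (by omega) (by omega)
        (by omega) (by omega) (by omega)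
      refine ⟨(p, 1), ?_⟩
      simp [cellDomino, aztecCell, h1, h2, Finset.pair_comm]
  have : (d = (c.1 + 1, c.2) ∨ d = (c.1, c.2 + 1)) ∨
      (c = (d.1 + 1, d.2) ∨ c = (d.1, d.2 + 1)) := by
    simp only [squareGrid, abs_eq (zero_le_one' ℤ)] at h
    simp only [Prod.ext_iff]
    omega
  rcases this with h | h
  · exact key c hc d hd h
  · rw [Finset.pair_comm]
    exact key d hd c hc h

theorem sum_cell_eq (n : ℕ) (a b : ℤ) :
    (∑ p : Fin n × Fin n, if (p.1 : ℤ) + (p.2 : ℤ) - n + 1 = a ∧ (p.1 : ℤ) - (p.2 : ℤ) = b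
      then 1 else 0 : ℕ) =
    if (-(n : ℤ) < a + b ∧ a + b < n ∧ -(n : ℤ) < a - b ∧ a - b < n) ∧ (a + b + n) % 2 = 1
      then 1 else 0 := by
  rw [← Finset.card_filter]
  split_ifs with h
  · obtain ⟨p, h1, h2⟩ := exists_cell h.1.1 h.1.2.1 h.1.2.2.1 h.1.2.2.2 h.2
    rw [Finset.card_eq_one]
    refine ⟨p, ?_⟩
    ext q
    simp only [Finset.mem_filter, Finset.mem_univ, true_and, Finset.mem_singleton, Prod.ext_iff,
      Fin.ext_iff]
    omega
  · rw [Finset.card_eq_zero, Finset.filter_eq_empty_iff]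
    rintro ⟨p, q⟩ _ ⟨h1, h2⟩
    have := p.2
    have := q.2
    simp only at h1 h2
    omega

-- Only two opposite corners of a square have the parity of a centre. By parity, both are centres
-- when the square has order `n`, and exactly one when it is new in order `n + 1`.
open Classical in
theorem coverCount_aztecCell (n : ℕ) (v : ℤ × ℤ) :
    coverCount (aztecCell (n + 1)) (fun _ => Finset.univ) v =
      (aztecDiamond (n + 1)).indicator 1 v + (aztecDiamond n).indicator 1 v := by
  obtain ⟨x, y⟩ := v
  have h : coverCount (aztecCell (n + 1)) (fun _ => Finset.univ) (x, y) =
      ∑ i, ∑ p : Fin (n + 1) × Fin (n + 1),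
        if (p.1 : ℤ) + (p.2 : ℤ) - (n + 1 : ℕ) + 1 = x - ![0, -1, -1, 0] i ∧
          (p.1 : ℤ) - (p.2 : ℤ) = y - ![0, 0, -1, -1] i then 1 else 0 := by
    rw [coverCount, Finset.sum_comm]
    refine Finset.sum_congr rfl fun i _ => Finset.sum_congr rfl fun p _ => ?_
    simp only [Finset.mem_univ, true_and, aztecCell, Prod.mk.injEq, eq_sub_iff_add_eq]
  rw [h, Fin.sum_univ_four]
  simp only [sum_cell_eq, Set.indicator_apply, mem_aztecDiamond, Pi.one_apply]
  simp only [Matrix.cons_val]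
  push_cast
  rcases Int.emod_two_eq_zero_or_one (x + y + n) with hp | hp
  · have h0 : (x - 0 + (y - 0) + ((n : ℤ) + 1)) % 2 = 1 := by omega
    have h1 : ¬ (x - -1 + (y - 0) + ((n : ℤ) + 1)) % 2 = 1 := by omega
    have h2 : (x - -1 + (y - -1) + ((n : ℤ) + 1)) % 2 = 1 := by omega
    have h3 : ¬ (x - 0 + (y - -1) + ((n : ℤ) + 1)) % 2 = 1 := by omega
    simp only [h0, h1, h2, h3, and_true, and_false, if_false]
    split_ifs <;> omega
  · have h0 : ¬ (x - 0 + (y - 0) + ((n : ℤ) + 1)) % 2 = 1 := by omega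
    have h1 : (x - -1 + (y - 0) + ((n : ℤ) + 1)) % 2 = 1 := by omega
    have h2 : ¬ (x - -1 + (y - -1) + ((n : ℤ) + 1)) % 2 = 1 := by omega
    have h3 : (x - 0 + (y - -1) + ((n : ℤ) + 1)) % 2 = 1 := by omega
    simp only [h0, h1, h2, h3, and_true, and_false, if_false]
    split_ifs <;> omega

theorem finite_aztecDiamond (n : ℕ) : (aztecDiamond n).Finite := by
  refine ((Set.finite_Icc (-(n : ℤ) - 1) n).prod (Set.finite_Icc (-(n : ℤ) - 1) n)).subset ?_
  intro c hc
  rw [mem_aztecDiamond] at hc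
  simp only [Set.mem_prod, Set.mem_Icc]
  omega

theorem aztecDiamond_subset_succ (n : ℕ) : aztecDiamond n ⊆ aztecDiamond (n + 1) := by
  intro c hc
  rw [mem_aztecDiamond] at hc ⊢
  omega

theorem aztecDiamond_zero : aztecDiamond 0 = ∅ := by
  ext c
  simp only [mem_aztecDiamond, Set.mem_empty_iff_false, iff_false]
  omega

-- Counting cell vertices gives `4 * (n + 1) ^ 2` as the sum of the sizes for orders `n + 1` and
-- `n`.
open Classical in
theorem card_aztecDiamond (n : ℕ) : (finite_aztecDiamond n).toFinset.card = 2 * (n * (n + 1)) := by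
  induction n with
  | zero => simp [aztecDiamond_zero]
  | succ n ih =>
    have h := sum_coverCount (S := (finite_aztecDiamond (n + 1)).toFinset)
      (fun p i => (Set.Finite.mem_toFinset _).2 (aztecCell_mem (n + 1) p i))
      fun _ => Finset.univ
    simp only [coverCount_aztecCell, Finset.sum_add_distrib, Set.indicator_apply, Pi.one_apply,
      ← Finset.card_filter, Finset.card_univ, Finset.sum_const, Fintype.card_prod, Fintype.card_fin,
      smul_eq_mul] at h
    have h1 : (finite_aztecDiamond (n + 1)).toFinset.filter (· ∈ aztecDiamond (n + 1)) =
        (finite_aztecDiamond (n + 1)).toFinset :=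
      Finset.filter_true_of_mem fun c hc => (Set.Finite.mem_toFinset _).1 hc
    have h2 : (finite_aztecDiamond (n + 1)).toFinset.filter (· ∈ aztecDiamond n) =
        (finite_aztecDiamond n).toFinset := by
      ext c
      simpa using @aztecDiamond_subset_succ n c
    rw [h1, h2, ih] at h
    linarith

theorem numDominoTilings_aztecDiamond_succ (n : ℕ) :
    numDominoTilings (aztecDiamond (n + 1)) = 2 ^ (n + 1) * numDominoTilings (aztecDiamond n) := by
  have h := two_pow_mul_numDominoTilings (S := (finite_aztecDiamond (n + 1)).toFinset)
    (S' := (finite_aztecDiamond n).toFinset) (aztecCell_adj (n + 1))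
    (cellDomino_aztecCell_injective (n + 1))
    (fun c hc d hd => exists_cellDomino_aztecCell ((Set.Finite.mem_toFinset _).1 hc)
      ((Set.Finite.mem_toFinset _).1 hd))
    (Set.Finite.toFinset_mono (aztecDiamond_subset_succ n))
    (fun p i => (Set.Finite.mem_toFinset _).2 (aztecCell_mem (n + 1) p i))
    (by simpa only [Set.Finite.coe_toFinset] using coverCount_aztecCell n)
  -- The powers of two are `(n + 1) ^ 2` on the left and `(n + 1) * (n + 2)` on the right; they
  -- differ by `n + 1`.
  rw [Set.Finite.coe_toFinset, Set.Finite.coe_toFinset, card_aztecDiamond, pow_mul,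
    Real.sq_sqrt (by norm_num), Fintype.card_prod, Fintype.card_fin,
    show (n + 1) * (n + 1 + 1) = (n + 1) * (n + 1) + (n + 1) by ring, pow_add, mul_assoc] at h
  exact_mod_cast mul_left_cancel₀ (by positivity) h

theorem numDominoTilings_aztecDiamond (n : ℕ) :
    numDominoTilings (aztecDiamond n) = 2 ^ (n * (n + 1) / 2) := by
  induction n with
  | zero =>
    have : {T : Set (Finset (ℤ × ℤ)) | IsDominoTiling ∅ T} = {∅} := by
      ext T
      simp only [IsDominoTiling, Set.mem_ofPred_eq, Set.mem_singleton_iff,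
        Set.eq_empty_iff_forall_notMem, Set.mem_empty_iff_false, false_imp_iff, implies_true,
        and_true]
      refine ⟨fun h s hs => ?_, fun h s hs => absurd hs (h s)⟩
      obtain ⟨⟨c, d, -, rfl⟩, h'⟩ := h s hs
      exact h' c (by simp)
    simp [numDominoTilings, aztecDiamond_zero, this]
  | succ n ih =>
    rw [numDominoTilings_aztecDiamond_succ, ih, ← pow_add,
      show (n + 1) * (n + 1 + 1) = n * (n + 1) + (n + 1) * 2 by ring,
      Nat.add_mul_div_right _ _ two_pos, add_comm]

theorem mainTheorem5 :
    (∀ n : ℕ, numDominoTilings (aztecDiamond n) = 2 ^ (n * (n + 1) / 2)) ∧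
    (∀ n : ℕ, numPerfectMatchings (dualGraph (aztecDiamond n)) = 2 ^ (n * (n + 1) / 2)) ∧
    (∀ n : ℕ, 1 ≤ n →
      numPerfectMatchings (dualGraph (aztecDiamond n)) =
        2 ^ n * numPerfectMatchings (dualGraph (aztecDiamond (n - 1)))) := by
  simp only [numPerfectMatchings_dualGraph]
  refine ⟨numDominoTilings_aztecDiamond, numDominoTilings_aztecDiamond, fun n hn => ?_⟩
  obtain ⟨m, rfl⟩ := Nat.exists_eq_add_of_le' hn
  exact numDominoTilings_aztecDiamond_succ m
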